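/- Let $n\ge 0$. Consider standard Young tableaux with $n$ boxes (entries $1,\dots,n$, each used once, increasing along rows and down columns) with at most two columns, and write $T=(T_1,T_2)$ for such a tableau with first column $T_1$ and (possibly empty) second column $T_2$; $\langle C\rangle$ denotes the set of entries of a column $C$. For a two-column tableau $P=(P_1,P_2)$ with distinct entries and a corner entry $u$ of $P$, define the tableau $P\Leftarrow u$ and the number $u^{P}$ as follows. If $u\in\langle P_1\rangle$, remove $u$ from $P_1$ and put $u^{P}:=u$. If $u\in\langle P_2\rangle$, remove $u$ from $P_2$, let $u^{P}$ be the greatest entry of $P_1$ smaller than $u$, and replace $u^{P}$ by $u$ in $P_1$. Given a tableau $T$ as above, put $T_{(n)}:=T$ and, for $i=n,n-1,\dots,1$, put $z_i:=\max\langle T_{(i)}\rangle$ (the largest entry of $T_{(i)}$), $a_i:=z_i^{T_{(i)}}$ and $T_{(i-1)}:=T_{(i)}\Leftarrow z_i$. Let $w_T:=[a_n,a_{n-1},\dots,a_1]$, a permutation of $\{1,\dots,n\}$ written as a word. For $x\in\langle T_2\rangle$ there is a unique $i$ with $2\le i\le n$ and $x=z_i=z_{i-1}$; put $T\{x\}:=T_{(i)}$.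 Then $x$ is the largest entry of $T\{x\}$ and lies in its second column. For permutations $w,y$ of $\{1,\dots,n\}$ written as words, let $p_w(i)$ be the position of the letter $i$ in $w$. Write $w\overset{D}{\le}y$ (right weak order) if for all $1\le i<j\le n$ the condition $p_w(j)<p_w(i)$ implies $p_y(j)<p_y(i)$, and $w\overset{D}{<}y$ if moreover $w\ne y$. **Lemma 3.9.** Let $T,S$ be standard Young tableaux with $n$ boxes and at most two columns. Then $w_T\overset{D}{<}w_S$ if and only if $\langle S_2\rangle\subsetneq\langle T_2\rangle$ and, for every $x\in\langle S_2\rangle$, $x^{S\{x\}}\in\langle T_1\rangle$. -/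

import Mathlib

namespace TwoColumn

/-- A semistandard filling `T` of the diagram `μ` is a standard Young tableau with `n` boxes and
at most two columns: the shape has `n` cells, all of them in column `0` or column `1`, and the
entries are exactly `1, …, n`, each occurring once (so rows, too, are strictly increasing). -/
structure IsStandard (n : ℕ) {μ : YoungDiagram} (T : SemistandardYoungTableau μ) : Prop where
  card_eq : μ.card = n
  two_columns : μ.rowLen 0 ≤ 2
  bijOn : Set.BijOn (fun c : ℕ × ℕ => T c.1 c.2) (μ.cells : Set (ℕ × ℕ)) (Set.Icc 1 n)

/-- A column, strictly increasing from top to bottom, is determined by the set of its entries and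
is represented by this set. A two-column array is the pair of its first and second columns. -/
abbrev Columns := Finset ℕ × Finset ℕ

/-- The set of entries of the column with index `j` (starting from `0`) of `T`. -/
def column {μ : YoungDiagram} (T : SemistandardYoungTableau μ) (j : ℕ) : Finset ℕ :=
  (μ.col j).image fun c => T c.1 c.2

/-- A tableau with at most two columns, written by columns `(T₁, T₂)`. -/
def columns {μ : YoungDiagram} (T : SemistandardYoungTableau μ) : Columns :=
  (column T 0, column T 1)

/-- The greatest entry of the column `C` smaller than `j` (used only when there is one): the
element pushed out of `C` when `j` is pushed left into `C`. -/
def pushedOut (C : Finset ℕ) (j : ℕ) : ℕ :=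
  (C.filter (· < j)).sup id

/-- Pushing `j` left into the column `C`: `j` takes the place of the greatest entry of `C` smaller
than `j`. -/
def pushLeft (C : Finset ℕ) (j : ℕ) : Finset ℕ :=
  insert j (C.erase (pushedOut C j))

/-- The array `P ⇐ a` left by deleting the corner entry `a` of `P`. A corner entry of the second
column is removed from it and pushed left into the first column; a corner entry of the first
column is just removed. -/
def deleteCorner (P : Columns) (a : ℕ) : Columns :=
  if a ∈ P.2 then (pushLeft P.1 a, P.2.erase a) else (P.1.erase a, P.2)

/-- The element `a^P` pushed out of the array `P` when the corner entry `a` is deleted. -/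
def deletedElement (P : Columns) (a : ℕ) : ℕ :=
  if a ∈ P.2 then pushedOut P.1 a else a

/-- The largest entry of a (nonempty) array. -/
def maxEntry (P : Columns) : ℕ :=
  (P.1 ∪ P.2).sup id

/-- The chain `P_(n) = P`, `P_(i-1) = P_(i) ⇐ max P_(i)`, for an array `P` with `n` entries and
`0 ≤ i ≤ n`. -/
def stage (n : ℕ) (P : Columns) (i : ℕ) : Columns :=
  (fun R => deleteCorner R (maxEntry R))^[n - i] P

/-- `z_i`, the largest entry of `P_(i)`. -/
def zEntry (n : ℕ) (P : Columns) (i : ℕ) : ℕ :=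
  maxEntry (stage n P i)

/-- `a_i`, the element pushed out when `z_i` is deleted from `P_(i)`. -/
def aEntry (n : ℕ) (P : Columns) (i : ℕ) : ℕ :=
  deletedElement (stage n P i) (zEntry n P i)

/-- The word `[a_n, a_{n-1}, …, a_1]` of an array. -/
def word (n : ℕ) (P : Columns) : List ℕ :=
  (List.range n).map fun k => aEntry n P (n - k)

/-- The array `P{x} = P_(i)`, for `x` in the second column of `P`, where `i` is the unique index
with `2 ≤ i ≤ n` and `z_i = z_{i-1} = x`. -/
def brace (n : ℕ) (P : Columns) (x : ℕ) : Columns :=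
  stage n P (Nat.findGreatest (fun i => 2 ≤ i ∧ zEntry n P i = x ∧ zEntry n P (i - 1) = x) n)

/-- The right weak order on permutations of `1, …, n` written as words: every pair of letters
`i < j` with `j` to the left of `i` in `w` has `j` to the left of `i` in `y`. -/
def WeakLE (n : ℕ) (w y : List ℕ) : Prop :=
  ∀ i j : ℕ, 1 ≤ i → i < j → j ≤ n → w.idxOf j < w.idxOf i → y.idxOf j < y.idxOf i

/-- The strict part of the right weak order. -/
def WeakLT (n : ℕ) (w y : List ℕ) : Prop :=
  WeakLE n w y ∧ w ≠ y

/-- The word `w_T` of a standard tableau `T` with `n` boxes and at most two columns. -/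
def canonicalWord (n : ℕ) {μ : YoungDiagram} (T : SemistandardYoungTableau μ) : List ℕ :=
  word n (columns T)

end TwoColumn

namespace TwoColumn

/-! When the maximum x lies in the second column, deleting it pushes out some u and puts x into the
first column, where x is again the maximum and is deleted next. So the word begins u, x and
continues with the word of the array without u and x. `Reads` follows this recursion and records the
pairs (u, x).

For i < j, the letter i precedes j exactly when i is in the first column and j is in the second and
pushes out some u ≤ i (`Reads.idxOf_lt_iff`). The relation w_T ≤ w_S says that every non-inversion
of w_S is one of w_T. Applied to the pairs (u, x) of S, it gives both conditions of the lemma.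
Conversely, an entry i of S_1 with u ≤ i < x is itself pushed out in S
(`Reads.exists_pair_of_between`), hence lies in T_1, and x pushes out of T an element at most u
(`Reads.pair_le_pair`). Strictness matches on both sides because the second column determines the
tableau. -/

/-! ### Readings and the deletion recursion. -/

/-- `Reads A B M w`: the array `(A, B)` has word `w`, and deleting the entries of `B` pushes out
the entries of `A` recorded by the set `M` of pairs `(pushed out, deleted)`. -/
inductive Reads : Finset ℕ → Finset ℕ → Finset (ℕ × ℕ) → List ℕ → Prop
  | nil : Reads ∅ ∅ ∅ []
  | left {A B M w x} : Reads A B M w → (∀ y ∈ A, y < x) → (∀ y ∈ B, y < x) →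
      Reads (insert x A) B M (x :: w)
  | right {A B M w u x} : Reads A B M w → (∀ y ∈ A, y < u) → (∀ y ∈ B, y < x) → u < x → u ∉ B →
      Reads (insert u A) (insert x B) (insert (u, x) M) (u :: x :: w)

/-- Deletion of the largest entry. -/
def deleteMax (P : Columns) : Columns :=
  deleteCorner P (maxEntry P)

theorem maxEntry_eq {A B : Finset ℕ} {x : ℕ} (hx : x ∈ A ∪ B) (h : ∀ y ∈ A ∪ B, y ≤ x) :
    maxEntry (A, B) = x :=
  le_antisymm (Finset.sup_le h) (Finset.le_sup (f := id) hx)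

theorem maxEntry_insert_left {A B : Finset ℕ} {x : ℕ} (hA : ∀ y ∈ A, y < x)
    (hB : ∀ y ∈ B, y < x) : maxEntry (insert x A, B) = x := by
  apply maxEntry_eq (by simp)
  grind

theorem maxEntry_insert_insert {A B : Finset ℕ} {u x : ℕ} (hA : ∀ y ∈ A, y < u)
    (hB : ∀ y ∈ B, y < x) (hu : u < x) : maxEntry (insert u A, insert x B) = x := by
  apply maxEntry_eq (by simp)
  grind

theorem deletedElement_insert_left {A B : Finset ℕ} {x : ℕ} (hB : ∀ y ∈ B, y < x) :
    deletedElement (insert x A, B) x = x :=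
  if_neg fun h => lt_irrefl x (hB x h)

theorem pushedOut_insert {A : Finset ℕ} {u x : ℕ} (hA : ∀ y ∈ A, y < u) (hu : u < x) :
    pushedOut (insert u A) x = u := by
  apply le_antisymm
  · apply Finset.sup_le
    intro y hy
    simp only [Finset.mem_filter, Finset.mem_insert, id] at *
    grind
  · exact Finset.le_sup (f := id) (by simp [hu])

theorem deletedElement_insert_insert {A B : Finset ℕ} {u x : ℕ} (hA : ∀ y ∈ A, y < u)
    (hu : u < x) : deletedElement (insert u A, insert x B) x = u := by
  simp [deletedElement, pushedOut_insert hA hu]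

theorem deleteMax_insert_left {A B : Finset ℕ} {x : ℕ} (hA : ∀ y ∈ A, y < x)
    (hB : ∀ y ∈ B, y < x) : deleteMax (insert x A, B) = (A, B) := by
  have h1 : x ∉ A := fun h => lt_irrefl x (hA x h)
  have h2 : x ∉ B := fun h => lt_irrefl x (hB x h)
  simp [deleteMax, maxEntry_insert_left hA hB, deleteCorner, h1, h2]

theorem deleteMax_insert_insert {A B : Finset ℕ} {u x : ℕ} (hA : ∀ y ∈ A, y < u)
    (hB : ∀ y ∈ B, y < x) (hu : u < x) :
    deleteMax (insert u A, insert x B) = (insert x A, B) := by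
  have h1 : u ∉ A := fun h => lt_irrefl u (hA u h)
  have h2 : x ∉ B := fun h => lt_irrefl x (hB x h)
  simp [deleteMax, maxEntry_insert_insert hA hB hu, deleteCorner, pushLeft,
    pushedOut_insert hA hu, h1, h2]

theorem stage_sub {n k : ℕ} (hk : k ≤ n) (P : Columns) :
    stage n P (n - k) = deleteMax^[k] P := by
  rw [stage, Nat.sub_sub_self hk]
  rfl

theorem word_eq_map (n : ℕ) (P : Columns) :
    word n P = (List.range n).map fun k =>
      deletedElement (deleteMax^[k] P) (maxEntry (deleteMax^[k] P)) := by
  apply List.map_congr_left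
  intro k hk
  rw [aEntry, zEntry, stage_sub (List.mem_range.1 hk).le]

theorem word_succ (n : ℕ) (P : Columns) :
    word (n + 1) P = deletedElement P (maxEntry P) :: word n (deleteMax P) := by
  simp [word_eq_map, List.range_succ_eq_map, Function.comp_def]

theorem Reads.word_eq {A B : Finset ℕ} {M : Finset (ℕ × ℕ)} {w : List ℕ} (h : Reads A B M w) :
    word w.length (A, B) = w := by
  induction h with
  | nil => rfl
  | left _ hA hB ih =>
    rw [List.length_cons, word_succ, maxEntry_insert_left hA hB, deleteMax_insert_left hA hB,
      deletedElement_insert_left hB, ih]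
  | right _ hA hB hu _ ih =>
    have hA' := fun y hy => (hA y hy).trans hu
    rw [List.length_cons, List.length_cons, word_succ, word_succ,
      maxEntry_insert_insert hA hB hu, deleteMax_insert_insert hA hB hu,
      deletedElement_insert_insert hA hu, maxEntry_insert_left hA' hB,
      deleteMax_insert_left hA' hB, deletedElement_insert_left hB, ih]

/-! ### Pushed-out pairs and non-inversions. -/

theorem Reads.mem_of_pair {A B : Finset ℕ} {M : Finset (ℕ × ℕ)} {w : List ℕ}
    (h : Reads A B M w) {u x : ℕ} (hM : (u, x) ∈ M) : u ∈ A ∧ x ∈ B ∧ u < x := by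
  induction h with
  | nil => simp at hM
  | left _ _ _ ih => grind
  | right _ _ _ _ _ ih => grind

theorem Reads.exists_pair {A B : Finset ℕ} {M : Finset (ℕ × ℕ)} {w : List ℕ}
    (h : Reads A B M w) {x : ℕ} (hx : x ∈ B) : ∃ u, (u, x) ∈ M := by
  induction h with
  | nil => simp at hx
  | left _ _ _ ih => exact ih hx
  | right _ _ _ _ _ ih => grind

theorem Reads.mem_iff {A B : Finset ℕ} {M : Finset (ℕ × ℕ)} {w : List ℕ}
    (h : Reads A B M w) (a : ℕ) : a ∈ w ↔ a ∈ A ∨ a ∈ B := by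
  induction h with
  | nil => simp
  | left _ _ _ ih => grind
  | right _ _ _ _ _ ih => grind

theorem Reads.disjoint {A B : Finset ℕ} {M : Finset (ℕ × ℕ)} {w : List ℕ}
    (h : Reads A B M w) {a : ℕ} (hA : a ∈ A) (hB : a ∈ B) : False := by
  induction h with
  | nil => simp at hA
  | left _ _ _ ih => grind
  | right _ _ _ _ _ ih => grind

/-- The pushed out elements increase strictly with the deleted ones. -/
theorem Reads.pair_strictMono {A B : Finset ℕ} {M : Finset (ℕ × ℕ)} {w : List ℕ}
    (h : Reads A B M w) {u x v y : ℕ} (hx : (u, x) ∈ M) (hy : (v, y) ∈ M) (hxy : x < y) :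
    u < v := by
  induction h with
  | nil => simp at hx
  | left _ _ _ ih => exact ih hx hy
  | right h _ _ _ _ ih =>
    have := fun u x => h.mem_of_pair (u := u) (x := x)
    grind

theorem Reads.pair_unique {A B : Finset ℕ} {M : Finset (ℕ × ℕ)} {w : List ℕ}
    (h : Reads A B M w) {u v x : ℕ} (hu : (u, x) ∈ M) (hv : (v, x) ∈ M) : u = v := by
  induction h with
  | nil => simp at hu
  | left _ _ _ ih => exact ih hu hv
  | right h _ _ _ _ ih =>
    have := fun u x => h.mem_of_pair (u := u) (x := x)
    grind

/-- An element of the first column between `u` and `x`, where `x` pushes out `u`, has itself been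
pushed out by some element. -/
theorem Reads.exists_pair_of_between {A B : Finset ℕ} {M : Finset (ℕ × ℕ)} {w : List ℕ}
    (h : Reads A B M w) {u x i : ℕ} (hx : (u, x) ∈ M) (hi : i ∈ A) (hui : u ≤ i) (hix : i < x) :
    ∃ y, (i, y) ∈ M ∧ x ≤ y := by
  -- When x is deleted, u is the largest entry left in the first column, so any i > u has already
  -- gone. It was not removed as a maximum, since i < x; hence it was pushed out.
  induction h with
  | nil => simp at hx
  | left h _ _ ih =>
    have := h.mem_of_pair hx
    grind
  | right h _ _ _ _ ih =>
    have := fun u x => h.mem_of_pair (u := u) (x := x)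
    grind

/-- The non-inversions of the word. -/
theorem Reads.idxOf_lt_iff {A B : Finset ℕ} {M : Finset (ℕ × ℕ)} {w : List ℕ}
    (h : Reads A B M w) {i j : ℕ} (hij : i < j) (hi : i ∈ A ∨ i ∈ B) (hj : j ∈ A ∨ j ∈ B) :
    w.idxOf i < w.idxOf j ↔ i ∈ A ∧ ∃ u, (u, j) ∈ M ∧ u ≤ i := by
  induction h with
  | nil => simp at hi
  | @left A B M w x h hA hB ih =>
    have := fun u x => h.mem_of_pair (u := u) (x := x)
    have hix : x ≠ i := by grind
    by_cases hjx : x = j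
    · subst hjx
      rw [List.idxOf_cons_self]
      grind
    · rw [List.idxOf_cons_ne _ hix, List.idxOf_cons_ne _ hjx, Nat.succ_lt_succ_iff,
        ih (by grind) (by grind)]
      grind
  | @right A B M w u x h hA hB hu huB ih =>
    have := fun u x => h.mem_of_pair (u := u) (x := x)
    have hix : x ≠ i := by grind
    by_cases hju : u = j
    · subst hju
      rw [List.idxOf_cons_self]
      grind
    by_cases hiu : u = i
    · subst hiu
      rw [List.idxOf_cons_self, List.idxOf_cons_ne _ hju]
      have : j ∈ insert x B := by grind
      refine iff_of_true (Nat.succ_pos _) ⟨by simp, ?_⟩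
      rcases Finset.mem_insert.1 this with rfl | hjB
      · exact ⟨u, by simp⟩
      · obtain ⟨v, hv⟩ := h.exists_pair hjB
        exact ⟨v, by simp [hv], (hA v (h.mem_of_pair hv).1).le⟩
    by_cases hjx : x = j
    · subst hjx
      rw [List.idxOf_cons_ne _ hiu, List.idxOf_cons_ne _ hju, List.idxOf_cons_self]
      grind
    · rw [List.idxOf_cons_ne _ hiu, List.idxOf_cons_ne _ hju, List.idxOf_cons_ne _ hix,
        List.idxOf_cons_ne _ hjx, Nat.succ_lt_succ_iff, Nat.succ_lt_succ_iff,
        ih (by grind) (by grind)]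
      grind

/-! ### The arrays P{x}. -/

/-- The maximum is x twice in a row: in the second column, then in the first. The last clause makes
t the least number of deletions reaching x, hence n - t the greatest index, as `brace` requires. -/
theorem Reads.exists_iterate {A B : Finset ℕ} {M : Finset (ℕ × ℕ)} {w : List ℕ}
    (h : Reads A B M w) {u x : ℕ} (hM : (u, x) ∈ M) :
    ∃ t, t + 2 ≤ w.length ∧ maxEntry (deleteMax^[t] (A, B)) = x ∧
      maxEntry (deleteMax^[t + 1] (A, B)) = x ∧ deletedElement (deleteMax^[t] (A, B)) x = u ∧
      ∀ s < t, maxEntry (deleteMax^[s] (A, B)) ≠ x := by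
  induction h with
  | nil => simp at hM
  | @left A B M w x₀ h hA hB ih =>
    have hx : x < x₀ := hB x (h.mem_of_pair hM).2.1
    obtain ⟨t, ht, h1, h2, h3, h4⟩ := ih hM
    refine ⟨t + 1, by simpa using ht, ?_⟩
    simp only [Function.iterate_succ_apply, deleteMax_insert_left hA hB] at h2 ⊢
    refine ⟨h1, h2, h3, fun s hs => ?_⟩
    cases s with
    | zero => simpa [maxEntry_insert_left hA hB] using hx.ne'
    | succ s =>
      simpa [deleteMax_insert_left hA hB] using h4 s (by omega)
  | @right A B M w u₀ x₀ h hA hB hu huB ih =>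
    have hA' := fun y hy => (hA y hy).trans hu
    rcases Finset.mem_insert.1 hM with heq | hM
    · obtain ⟨rfl, rfl⟩ := Prod.mk.inj heq
      refine ⟨0, by simp, ?_⟩
      simp [maxEntry_insert_insert hA hB hu, deleteMax_insert_insert hA hB hu,
        maxEntry_insert_left hA' hB, deletedElement_insert_insert hA hu]
    · have hx : x < x₀ := hB x (h.mem_of_pair hM).2.1
      obtain ⟨t, ht, h1, h2, h3, h4⟩ := ih hM
      refine ⟨t + 2, by simpa using ht, ?_⟩
      simp only [Function.iterate_succ_apply, deleteMax_insert_insert hA hB hu,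
        deleteMax_insert_left hA' hB] at h2 ⊢
      refine ⟨h1, h2, h3, fun s hs => ?_⟩
      match s with
      | 0 => simpa [maxEntry_insert_insert hA hB hu] using hx.ne'
      | 1 => simpa [deleteMax_insert_insert hA hB hu, maxEntry_insert_left hA' hB] using hx.ne'
      | s + 2 =>
        simpa [deleteMax_insert_insert hA hB hu, deleteMax_insert_left hA' hB] using
          h4 s (by omega)

theorem Reads.deletedElement_brace {A B : Finset ℕ} {M : Finset (ℕ × ℕ)} {w : List ℕ}
    (h : Reads A B M w) {u x : ℕ} (hM : (u, x) ∈ M) :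
    deletedElement (brace w.length (A, B) x) x = u := by
  obtain ⟨t, ht, h1, h2, h3, h4⟩ := h.exists_iterate hM
  have key : Nat.findGreatest (fun i => 2 ≤ i ∧ zEntry w.length (A, B) i = x ∧
      zEntry w.length (A, B) (i - 1) = x) w.length = w.length - t := by
    rw [Nat.findGreatest_eq_iff]
    refine ⟨by omega, fun _ => ⟨by omega, ?_, ?_⟩, fun {i} hi hi' hP => ?_⟩
    · rw [zEntry, stage_sub (by omega), h1]
    · rw [Nat.sub_sub, zEntry, stage_sub (by omega), h2]
    · apply h4 (w.length - i) (by omega)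
      rw [← stage_sub (Nat.sub_le _ _), Nat.sub_sub_self hi']
      exact hP.2.1
  rw [brace, key, stage_sub (by omega), h3]

/-! ### Existence of readings. -/

/-- An array whose columns are disjoint and satisfy the ballot condition has a reading. -/
theorem exists_reads (n : ℕ) : ∀ A B : Finset ℕ, A.card + B.card = n → Disjoint A B →
    (∀ x ∈ B, (B.filter (· ≤ x)).card ≤ (A.filter (· < x)).card) →
    ∃ M w, Reads A B M w ∧ w.length = n := by
  induction n using Nat.strong_induction_on with
  | _ n ih =>
  intro A B hn hAB hb
  have hdis := Finset.disjoint_left.1 hAB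
  rcases (A ∪ B).eq_empty_or_nonempty with hE | hE
  · obtain ⟨rfl, rfl⟩ := Finset.union_eq_empty.1 hE
    exact ⟨∅, [], .nil, by simpa using hn⟩
  obtain ⟨x, hx, hmax⟩ := (A ∪ B).exists_max_image id hE
  have hAle : ∀ y ∈ A, y ≤ x := fun y hy => hmax y (Finset.mem_union_left _ hy)
  have hBle : ∀ y ∈ B, y ≤ x := fun y hy => hmax y (Finset.mem_union_right _ hy)
  rcases Finset.mem_union.1 hx with hxA | hxB
  · have hxB := hdis hxA
    have hBlt : ∀ y ∈ B, y < x := fun y hy =>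
      (hBle y hy).lt_of_ne (ne_of_mem_of_not_mem hy hxB)
    have hc := Finset.card_erase_add_one hxA
    obtain ⟨M, w, hR, hw⟩ := ih (n - 1) (by omega) (A.erase x) B (by omega)
      (hAB.mono_left (Finset.erase_subset _ _)) (by
        intro y hy
        convert hb y hy using 2
        ext z
        have := hBlt y hy
        simp only [Finset.mem_filter, Finset.mem_erase]
        grind only)
    refine ⟨M, x :: w, ?_, by simp [hw]; omega⟩
    rw [← Finset.insert_erase hxA]
    exact .left hR (fun y hy => (hAle y (Finset.mem_of_mem_erase hy)).lt_of_ne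
      (Finset.ne_of_mem_erase hy)) hBlt
  · have hxA : x ∉ A := fun h => hdis h hxB
    have hAlt : ∀ y ∈ A, y < x := fun y hy =>
      (hAle y hy).lt_of_ne (ne_of_mem_of_not_mem hy hxA)
    have hcard : B.card ≤ A.card := by
      have := hb x hxB
      rwa [Finset.filter_true_of_mem hBle, Finset.filter_true_of_mem hAlt] at this
    have hcB := Finset.card_erase_add_one hxB
    have hA : A.Nonempty := Finset.card_pos.1 (by omega)
    obtain ⟨u, hu, humax⟩ := A.exists_max_image id hA
    simp only [id] at humax
    have hult : ∀ y ∈ A.erase u, y < u := fun y hy =>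
      (humax y (Finset.mem_of_mem_erase hy)).lt_of_ne (Finset.ne_of_mem_erase hy)
    have hBlt : ∀ y ∈ B.erase x, y < x := fun y hy =>
      (hBle y (Finset.mem_of_mem_erase hy)).lt_of_ne (Finset.ne_of_mem_erase hy)
    have huB : u ∉ B.erase x := fun h => hdis hu (Finset.mem_of_mem_erase h)
    have hcA := Finset.card_erase_add_one hu
    obtain ⟨M, w, hR, hw⟩ := ih (n - 2) (by omega) (A.erase u) (B.erase x) (by omega)
      (hAB.mono (Finset.erase_subset _ _) (Finset.erase_subset _ _)) (by
        intro y hy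
        have hyB := Finset.mem_of_mem_erase hy
        -- If u < y, all of A counts in the ballot condition at y, and |B| ≤ |A| survives removing
        -- one element from each side. Otherwise u was not counted.
        by_cases huy : u < y
        · rw [Finset.filter_true_of_mem (s := A.erase u) fun z hz => (hult z hz).trans huy]
          have := Finset.card_filter_le (B.erase x) (· ≤ y)
          omega
        · have h1 : (A.erase u).filter (· < y) = A.filter (· < y) := by
            ext z
            simp only [Finset.mem_filter, Finset.mem_erase]
            grind only
          rw [h1]
          exact (Finset.card_le_card (Finset.filter_subset_filter _
            (Finset.erase_subset _ _))).trans (hb y hyB))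
    refine ⟨insert (u, x) M, u :: x :: w, ?_, by simp [hw]; omega⟩
    rw [← Finset.insert_erase hu, ← Finset.insert_erase hxB]
    exact .right hR hult hBlt (hAlt u hu) huB

/-! ### Comparison in the weak order. -/

/-- If the second column of `(A, B)` is contained in that of `(A', B')` and the elements pushed
out of `(A, B)` stay in `A'`, then each deletion pushes out of `(A', B')` a smaller element. -/
theorem Reads.pair_le_pair {A B A' B' : Finset ℕ} {M M' : Finset (ℕ × ℕ)} {w w' : List ℕ}
    (h : Reads A B M w) (h' : Reads A' B' M' w') (hA : A' ⊆ A) (hB : B ⊆ B')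
    {u v x : ℕ} (hu : (u, x) ∈ M) (hv : (v, x) ∈ M') : v ≤ u := by
  by_contra! hlt
  -- A violation u < v at x produces another at some larger y in B, since v is pushed out of (A, B)
  -- by such a y; B is finite.
  induction hk : B.sup id - x using Nat.strong_induction_on generalizing u v x with
  | _ k ih =>
  have hvA := h'.mem_of_pair hv
  obtain ⟨y, hy, hxy⟩ := h.exists_pair_of_between hu (hA hvA.1) hlt.le hvA.2.2
  have hne : x ≠ y := by
    rintro rfl
    exact hlt.ne (h.pair_unique hu hy)
  have hyB := (h.mem_of_pair hy).2.1
  have hle : y ≤ B.sup id := Finset.le_sup (f := id) hyB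
  obtain ⟨v', hv'⟩ := h'.exists_pair (hB hyB)
  exact ih _ (by omega) hy hv' (h'.pair_strictMono hv hv' (by omega)) rfl

theorem Reads.weakLE_iff {n : ℕ} {A B A' B' : Finset ℕ} {M M' : Finset (ℕ × ℕ)} {w w' : List ℕ}
    (h : Reads A B M w) (h' : Reads A' B' M' w') (hn : A ∪ B = Finset.Icc 1 n)
    (hn' : A' ∪ B' = Finset.Icc 1 n) :
    WeakLE n w' w ↔ B ⊆ B' ∧ ∀ u x, (u, x) ∈ M → u ∈ A' := by
  have hmem : ∀ i, i ∈ A ∨ i ∈ B ↔ 1 ≤ i ∧ i ≤ n := fun i => by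
    rw [← Finset.mem_union, hn, Finset.mem_Icc]
  have hmem' : ∀ i, i ∈ A' ∨ i ∈ B' ↔ 1 ≤ i ∧ i ≤ n := fun i => by
    rw [← Finset.mem_union, hn', Finset.mem_Icc]
  have hcontra : WeakLE n w' w ↔ ∀ i j, 1 ≤ i → i < j → j ≤ n →
      w.idxOf i < w.idxOf j → w'.idxOf i < w'.idxOf j := by
    -- Distinct letters have distinct positions, so contraposition turns inversions into
    -- non-inversions.
    refine forall₅_congr fun i j hi hij hj => ?_
    have h1 : w.idxOf i ≠ w.idxOf j := fun e =>
      hij.ne (List.idxOf_inj ((h.mem_iff i).2 ((hmem i).2 ⟨hi, by omega⟩)) |>.1 e)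
    have h2 : w'.idxOf i ≠ w'.idxOf j := fun e =>
      hij.ne (List.idxOf_inj ((h'.mem_iff i).2 ((hmem' i).2 ⟨hi, by omega⟩)) |>.1 e)
    omega
  rw [hcontra]
  constructor
  · intro hle
    have key : ∀ u x, (u, x) ∈ M → u ∈ A' ∧ x ∈ B' := by
      intro u x hux
      obtain ⟨hu, hx, hlt⟩ := h.mem_of_pair hux
      have hu' := (hmem u).1 (.inl hu)
      have hx' := (hmem x).1 (.inr hx)
      have := hle u x hu'.1 hlt hx'.2
        ((h.idxOf_lt_iff hlt (.inl hu) (.inr hx)).2 ⟨hu, u, hux, le_rfl⟩)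
      obtain ⟨h1, v, hv, -⟩ :=
        (h'.idxOf_lt_iff hlt ((hmem' u).2 hu') ((hmem' x).2 hx')).1 this
      exact ⟨h1, (h'.mem_of_pair hv).2.1⟩
    refine ⟨fun x hx => ?_, fun u x hux => (key u x hux).1⟩
    obtain ⟨u, hu⟩ := h.exists_pair hx
    exact (key u x hu).2
  · rintro ⟨hB, hM⟩ i j hi hij hj hlt
    have hA : A' ⊆ A := fun a ha =>
      ((hmem a).2 ((hmem' a).1 (.inl ha))).resolve_right fun hb => h'.disjoint ha (hB hb)
    obtain ⟨hiA, u, hu, hui⟩ := (h.idxOf_lt_iff hij ((hmem i).2 ⟨hi, by omega⟩)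
      ((hmem j).2 ⟨by omega, hj⟩)).1 hlt
    obtain ⟨y, hy, -⟩ := h.exists_pair_of_between hu hiA hui hij
    obtain ⟨v, hv⟩ := h'.exists_pair (hB (h.mem_of_pair hu).2.1)
    exact (h'.idxOf_lt_iff hij ((hmem' i).2 ⟨hi, by omega⟩) ((hmem' j).2 ⟨by omega, hj⟩)).2
      ⟨hM _ _ hy, v, hv, (h.pair_le_pair h' hA hB hu hv).trans hui⟩

/-! ### Columns of standard tableaux. -/

theorem mem_column {μ : YoungDiagram} (T : SemistandardYoungTableau μ) {j a : ℕ} :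
    a ∈ column T j ↔ ∃ r, (r, j) ∈ μ ∧ T r j = a := by
  simp only [column, Finset.mem_image, YoungDiagram.mem_col_iff, Prod.exists]
  constructor
  · rintro ⟨r, c, ⟨h, rfl⟩, rfl⟩
    exact ⟨r, h, rfl⟩
  · rintro ⟨r, h, rfl⟩
    exact ⟨r, j, ⟨h, rfl⟩, rfl⟩

theorem IsStandard.eq_of_entry_eq {n : ℕ} {μ : YoungDiagram} {T : SemistandardYoungTableau μ}
    (hT : IsStandard n T) {r j r' j' : ℕ} (h : (r, j) ∈ μ) (h' : (r', j') ∈ μ)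
    (e : T r j = T r' j') : r = r' ∧ j = j' :=
  Prod.mk.inj (hT.bijOn.injOn (x₁ := (r, j)) (x₂ := (r', j')) h h' e)

theorem IsStandard.column_union {n : ℕ} {μ : YoungDiagram} {T : SemistandardYoungTableau μ}
    (hT : IsStandard n T) : column T 0 ∪ column T 1 = Finset.Icc 1 n := by
  ext a
  rw [Finset.mem_union, mem_column, mem_column, ← Finset.mem_coe, Finset.coe_Icc]
  constructor
  · rintro (⟨r, h, rfl⟩ | ⟨r, h, rfl⟩) <;> exact hT.bijOn.mapsTo h
  · intro ha
    obtain ⟨⟨r, j⟩, h, rfl⟩ := hT.bijOn.surjOn ha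
    have h : (r, j) ∈ μ := h
    have hj : j < 2 := (YoungDiagram.mem_iff_lt_rowLen.1 h).trans_le
      ((μ.rowLen_anti 0 r (Nat.zero_le r)).trans hT.two_columns)
    interval_cases j
    · exact .inl ⟨r, h, rfl⟩
    · exact .inr ⟨r, h, rfl⟩

theorem IsStandard.column_disjoint {n : ℕ} {μ : YoungDiagram} {T : SemistandardYoungTableau μ}
    (hT : IsStandard n T) : Disjoint (column T 0) (column T 1) := by
  refine Finset.disjoint_left.2 fun a h0 h1 => ?_
  obtain ⟨r, h, rfl⟩ := (mem_column T).1 h0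
  obtain ⟨r', h', e⟩ := (mem_column T).1 h1
  exact absurd (hT.eq_of_entry_eq h' h e).2 one_ne_zero

/-- Sending a second-column entry to its left neighbour is injective and strictly lowers it. -/
theorem IsStandard.ballot {n : ℕ} {μ : YoungDiagram} {T : SemistandardYoungTableau μ}
    (hT : IsStandard n T) (x : ℕ) :
    ((column T 1).filter (· ≤ x)).card ≤ ((column T 0).filter (· < x)).card := by
  have hrow : ∀ y, ∃ r, y ∈ column T 1 → (r, 1) ∈ μ ∧ T r 1 = y := fun y => by
    by_cases hy : y ∈ column T 1
    · obtain ⟨r, hr⟩ := (mem_column T).1 hy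
      exact ⟨r, fun _ => hr⟩
    · exact ⟨0, fun h => absurd h hy⟩
  choose r hr using hrow
  have hcell : ∀ y ∈ column T 1, (r y, 0) ∈ μ := fun y hy =>
    μ.up_left_mem le_rfl zero_le_one (hr y hy).1
  refine Finset.card_le_card_of_injOn (fun y => T (r y) 0) (fun y hy => ?_) fun y hy z hz e => ?_
  · obtain ⟨hy, hyx⟩ := Finset.mem_filter.1 hy
    have hle := T.row_weak zero_lt_one (hr y hy).1
    have hne : T (r y) 0 ≠ T (r y) 1 := fun e =>
      absurd (hT.eq_of_entry_eq (hcell y hy) (hr y hy).1 e).2 zero_ne_one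
    have := (hr y hy).2
    exact Finset.mem_filter.2 ⟨(mem_column T).2 ⟨_, hcell y hy, rfl⟩,
      (hle.lt_of_ne hne).trans_le (this.trans_le hyx)⟩
  · have hy := (Finset.mem_filter.1 hy).1
    have hz := (Finset.mem_filter.1 hz).1
    rw [← (hr y hy).2, ← (hr z hz).2, (hT.eq_of_entry_eq (hcell y hy) (hcell z hz) e).1]

theorem IsStandard.exists_reads {n : ℕ} {μ : YoungDiagram} {T : SemistandardYoungTableau μ}
    (hT : IsStandard n T) :
    ∃ M, Reads (column T 0) (column T 1) M (canonicalWord n T) ∧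
      (canonicalWord n T).length = n := by
  have hcard : (column T 0).card + (column T 1).card = n := by
    rw [← Finset.card_union_of_disjoint hT.column_disjoint, hT.column_union, Nat.card_Icc,
      Nat.add_sub_cancel]
  obtain ⟨M, w, hR, hw⟩ := TwoColumn.exists_reads n _ _ hcard hT.column_disjoint
    fun x _ => hT.ballot x
  have : canonicalWord n T = w := by
    rw [← hR.word_eq, hw]
    rfl
  exact ⟨M, this ▸ hR, this ▸ hw⟩

end TwoColumn

theorem lemma3p9 (n : ℕ) {μ ν : YoungDiagram}
    (T : SemistandardYoungTableau μ) (S : SemistandardYoungTableau ν)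
    (hT : TwoColumn.IsStandard n T) (hS : TwoColumn.IsStandard n S) :
    TwoColumn.WeakLT n (TwoColumn.canonicalWord n T) (TwoColumn.canonicalWord n S) ↔
      TwoColumn.column S 1 ⊂ TwoColumn.column T 1 ∧
        ∀ x ∈ TwoColumn.column S 1,
          TwoColumn.deletedElement (TwoColumn.brace n (TwoColumn.columns S) x) x ∈
            TwoColumn.column T 0 := by
  obtain ⟨M, hR, hw⟩ := hS.exists_reads
  obtain ⟨M', hR', -⟩ := hT.exists_reads
  have hbrace : ∀ u x, (u, x) ∈ M →
      TwoColumn.deletedElement (TwoColumn.brace n (TwoColumn.columns S) x) x = u := by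
    intro u x hux
    have := hR.deletedElement_brace hux
    rwa [hw] at this
  have hpairs : (∀ u x, (u, x) ∈ M → u ∈ TwoColumn.column T 0) ↔
      ∀ x ∈ TwoColumn.column S 1,
        TwoColumn.deletedElement (TwoColumn.brace n (TwoColumn.columns S) x) x ∈
          TwoColumn.column T 0 := by
    constructor
    · intro h x hx
      obtain ⟨u, hu⟩ := hR.exists_pair hx
      rw [hbrace u x hu]
      exact h u x hu
    · intro h u x hux
      rw [← hbrace u x hux]
      exact h x (hR.mem_of_pair hux).2.1
  rw [TwoColumn.WeakLT, hR.weakLE_iff hR' hS.column_union hT.column_union, hpairs,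
    and_right_comm, Finset.ssubset_iff_subset_ne]
  -- Equal words are comparable both ways, which forces equal second columns; equal second columns
  -- have equal complements in 1, …, n, hence equal words.
  refine and_congr_left fun _ => and_congr_right fun _ => not_congr ⟨fun e => ?_, fun e => ?_⟩
  · have hTS : TwoColumn.WeakLE n (TwoColumn.canonicalWord n T) (TwoColumn.canonicalWord n S) :=
      e ▸ fun _ _ _ _ _ h => h
    have hST : TwoColumn.WeakLE n (TwoColumn.canonicalWord n S) (TwoColumn.canonicalWord n T) :=
      e ▸ fun _ _ _ _ _ h => h
    exact ((hR.weakLE_iff hR' hS.column_union hT.column_union).1 hTS).1.antisymm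
      ((hR'.weakLE_iff hR hT.column_union hS.column_union).1 hST).1
  · have h0 : TwoColumn.column S 0 = TwoColumn.column T 0 := by
      rw [← Finset.union_sdiff_cancel_right hS.column_disjoint, hS.column_union, e,
        ← hT.column_union, Finset.union_sdiff_cancel_right hT.column_disjoint]
    rw [TwoColumn.canonicalWord, TwoColumn.canonicalWord, TwoColumn.columns, TwoColumn.columns,
      h0, e]
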